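/- Let $m\ge 1$ and let $\lambda_1,\dots,\lambda_m>0$. A seller offers $m$ goods to one buyer with additive valuations, whose value $x_j$ for good $j$ is exponentially distributed with parameter $\lambda_j$, independently across goods (the $\lambda_j$ need not be equal). A mechanism consists of an allocation $a:\mathbb R_+^m\to[0,1]^m$ and a payment $p:\mathbb R_+^m\to\mathbb R_+$; it is individually rational if $a(x)\cdot x-p(x)\ge 0$ for all $x\in\mathbb R_+^m$, and incentive compatible if $a(x)\cdot x-p(x)\ge a(x')\cdot x-p(x')$ for all $x,x'\in\mathbb R_+^m$. Let $\mathrm{Rev}(F)$ denote the supremum of the expected payment $\mathbb E_{x\sim F}[p(x)]$ over all individually rational and incentive compatible mechanisms, and for a product distribution $F=F_1\times\dots\times F_m$ let $\mathrm{SRev}(F)=\sum_{j=1}^m\mathrm{Rev}(F_j)$, the optimal revenue from selling the items separately. Put $$\Gamma(m,w)=\int_w^\infty t^{m-1}e^{-t}\,dt,\qquad g(m,w)=\Gamma(m+1,w)-(m+1)\Gamma(m,w),\qquad G(m)=\int_0^\infty\max\{0,g(m,w)\}\,dw.$$ Then, for $\mathcal E=\mathcal E(\lambda_1)\times\dots\times\mathcal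 E(\lambda_m)$, we have $G(m)>0$, $0<\mathrm{SRev}(\mathcal E)<\infty$, and $$\frac{\mathrm{Rev}(\mathcal E)}{\mathrm{SRev}(\mathcal E)}\le \frac{G(m)}{m!}\,e<e .$$ Equivalently, $\mathrm{SRev}(\mathcal E)\ge \dfrac{1}{e\,G(m)/m!}\,\mathrm{Rev}(\mathcal E)$; in particular $\dfrac{G(m)}{m!}<1$. -/

import Mathlib

open MeasureTheory ProbabilityTheory
open scoped ENNReal Nat

noncomputable section

namespace Monopoly

/-- A direct-revelation selling mechanism for the goods `j : ι` and a buyer with additive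
valuations in the nonnegative orthant `Set.Ici 0`: allocation probabilities `alloc x j ∈ [0, 1]`
(lotteries are allowed) and a payment `payment x ≥ 0` for every reported valuation vector `x`.
Values outside the orthant are irrelevant. -/
structure Mechanism (ι : Type*) where
  alloc : (ι → ℝ) → ι → ℝ
  payment : (ι → ℝ) → ℝ
  alloc_mem : ∀ x ∈ Set.Ici (0 : ι → ℝ), ∀ j, alloc x j ∈ Set.Icc (0 : ℝ) 1
  payment_nonneg : ∀ x ∈ Set.Ici (0 : ι → ℝ), 0 ≤ payment x

variable {ι : Type*} [Fintype ι]

/-- `M.utility x' x` is the utility `u(x' | x)` of a buyer with true valuations `x` who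
reports `x'`. -/
def Mechanism.utility (M : Mechanism ι) (x' x : ι → ℝ) : ℝ :=
  ∑ j, M.alloc x' j * x j - M.payment x'

/-- Individual rationality. -/
def Mechanism.IR (M : Mechanism ι) : Prop :=
  ∀ x ∈ Set.Ici (0 : ι → ℝ), 0 ≤ M.utility x x

/-- Incentive compatibility (truthfulness). -/
def Mechanism.IC (M : Mechanism ι) : Prop :=
  ∀ x ∈ Set.Ici (0 : ι → ℝ), ∀ x' ∈ Set.Ici (0 : ι → ℝ), M.utility x' x ≤ M.utility x x

/-- Expected revenue of a truthfully played mechanism when the valuation vector has law `F` on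
the nonnegative orthant.  (For an IC mechanism and a law `F` that has a density, the payment is
automatically almost everywhere measurable, so no measurability is imposed.) -/
def Mechanism.revenue (M : Mechanism ι) (F : Measure (ι → ℝ)) : ℝ≥0∞ :=
  ∫⁻ x in Set.Ici (0 : ι → ℝ), ENNReal.ofReal (M.payment x) ∂F

/-- `Rev(F)`: the supremum of the expected revenue over all IR and IC mechanisms. -/
def Rev (F : Measure (ι → ℝ)) : ℝ≥0∞ :=
  ⨆ (M : Mechanism ι) (_ : M.IR) (_ : M.IC), M.revenue F

/-- `SRev(F₁ × ⋯ × Fₘ) = Rev(F₁) + ⋯ + Rev(Fₘ)`: optimal revenue from selling every item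
separately.  `Rev(F j)` is the optimal revenue of the one-good problem with value law `F j`. -/
def SRev (F : ι → Measure ℝ) : ℝ≥0∞ :=
  ∑ j, Rev (Measure.pi fun _ : Unit => F j)

/-- Upper incomplete Gamma function `Γ(m, w) = ∫_w^∞ t ^ (m - 1) * exp (-t) dt`, for positive
integers `m`. -/
def upperGamma (m : ℕ) (w : ℝ) : ℝ :=
  ∫ t in Set.Ioi w, t ^ (m - 1) * Real.exp (-t)

/-- `g(m, w) = Γ(m + 1, w) - (m + 1) Γ(m, w)`. -/
def g (m : ℕ) (w : ℝ) : ℝ :=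
  upperGamma (m + 1) w - (m + 1) * upperGamma m w

/-- `G(m) = ∫_0^∞ max {0, g(m, w)} dw`. -/
def G (m : ℕ) : ℝ :=
  ∫ w in Set.Ioi (0 : ℝ), max 0 (g m w)

end Monopoly

end

namespace Monopoly

open Set Filter Topology

/-! On the orthant the density is `∏ λ_j · exp (-ℓ x)` with `ℓ x = ∑ λ_j x_j`, so along a ray `r ↦ r
• y` normalised by `ℓ y = 1` it is a constant times `e^{-r}`, whatever the `λ_j`. Relax incentive
compatibility to rays from the origin and bound the revenue ray by ray. On such a ray the truthful
utility `u` is convex, vanishes at 0 and has slopes in `[0, c]`, where `c = ∑ y_j`; the payment is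
at most `t u' - u`. With the polar weight `t^{m-1} e^{-t}`, integration by parts gives `∫ (t u' - u)
t^{m-1} e^{-t} = ∫ u' g(m, t) dt ≤ c G(m)` (`lintegral_virtual_value_le`). The sum of the values
integrates along the same ray to `c m!`. Comparing rays (`lintegral_le_of_ray_le`), revenue is at
most `G(m)/m!` times `E ∑ x_j = ∑ 1/λ_j` (`Rev_pi_expMeasure_le`). Posting the price `1/λ_j` for
good `j` earns `e^{-1}/λ_j`, so `∑ 1/λ_j ≤ e · SRev`, and the ratio follows. Payments need not be
measurable, so they are first replaced by the measurable majorant `virtualPayment`. -/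

/-! ### Incomplete Gamma functions and the bounds `0 < G m < m!`. -/

lemma integrableOn_pow_mul_exp_neg (n : ℕ) :
    IntegrableOn (fun t : ℝ => t ^ n * Real.exp (-t)) (Ioi 0) := by
  have h := Real.GammaIntegral_convergent (s := n + 1) (by positivity)
  refine h.congr_fun (fun t _ => ?_) measurableSet_Ioi
  simp [mul_comm]

lemma integral_pow_mul_exp_neg (n : ℕ) :
    ∫ t in Ioi (0 : ℝ), t ^ n * Real.exp (-t) = n ! := by
  rw [← Real.Gamma_nat_eq_factorial, Real.Gamma_eq_integral (by positivity)]
  refine setIntegral_congr_fun measurableSet_Ioi fun t _ => ?_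
  simp [mul_comm]

lemma upperGamma_eq_sub (m : ℕ) {w : ℝ} (hw : 0 ≤ w) :
    upperGamma m w = upperGamma m 0 - ∫ t in (0 : ℝ)..w, t ^ (m - 1) * Real.exp (-t) := by
  rw [eq_sub_iff_add_eq, upperGamma, upperGamma, intervalIntegral.integral_of_le hw, add_comm,
    ← setIntegral_union (Ioc_disjoint_Ioi le_rfl) measurableSet_Ioi, Ioc_union_Ioi_eq_Ioi hw]
  · exact (integrableOn_pow_mul_exp_neg _).mono_set Ioc_subset_Ioi_self
  · exact (integrableOn_pow_mul_exp_neg _).mono_set (Ioi_subset_Ioi hw)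

lemma hasDerivAt_upperGamma (m : ℕ) {w : ℝ} (hw : 0 < w) :
    HasDerivAt (upperGamma m) (-(w ^ (m - 1) * Real.exp (-w))) w := by
  have hc : Continuous fun t : ℝ => t ^ (m - 1) * Real.exp (-t) := by fun_prop
  have h1 := intervalIntegral.integral_hasDerivAt_right (hc.intervalIntegrable 0 w)
    (hc.stronglyMeasurableAtFilter _ _) hc.continuousAt
  refine (h1.const_sub (upperGamma m 0)).congr_of_eventuallyEq ?_
  filter_upwards [Ioi_mem_nhds hw] with s hs using upperGamma_eq_sub m (le_of_lt hs)

lemma continuousOn_upperGamma (m : ℕ) : ContinuousOn (upperGamma m) (Ici 0) := by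
  have hc : Continuous fun t : ℝ => t ^ (m - 1) * Real.exp (-t) := by fun_prop
  have h1 : Continuous fun s : ℝ =>
      upperGamma m 0 - ∫ t in (0 : ℝ)..s, t ^ (m - 1) * Real.exp (-t) :=
    continuous_const.sub (intervalIntegral.continuous_primitive
      (fun a b => hc.intervalIntegrable a b) 0)
  exact h1.continuousOn.congr fun s hs => upperGamma_eq_sub m hs

lemma upperGamma_pos (m : ℕ) {w : ℝ} (hw : 0 ≤ w) : 0 < upperGamma m w := by
  rw [upperGamma, setIntegral_pos_iff_support_of_nonneg_ae]
  · refine lt_of_lt_of_le ?_ (measure_mono (s := Ioi w) fun t ht => ⟨?_, ht⟩)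
    · simp
    · have : 0 < t := hw.trans_lt ht
      simp only [Function.mem_support]; positivity
  · filter_upwards [ae_restrict_mem measurableSet_Ioi] with t ht
    have : 0 < t := hw.trans_lt ht
    simp only [Pi.zero_apply]; positivity
  · exact (integrableOn_pow_mul_exp_neg _).mono_set (Ioi_subset_Ioi hw)

/-- Makes the boundary term `u R * upperGamma m R` of the integration by parts vanish at infinity
when `u` grows at most linearly. -/
lemma mul_upperGamma_le {m : ℕ} (hm : 0 < m) {w : ℝ} (hw : 0 ≤ w) :
    w * upperGamma m w ≤ upperGamma (m + 1) w := by
  rw [upperGamma, upperGamma, ← integral_const_mul]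
  refine setIntegral_mono_on
    (((integrableOn_pow_mul_exp_neg _).mono_set (Ioi_subset_Ioi hw)).const_mul w)
    ((integrableOn_pow_mul_exp_neg _).mono_set (Ioi_subset_Ioi hw)) measurableSet_Ioi
    fun t (ht : w < t) => ?_
  obtain ⟨k, rfl⟩ : ∃ k, m = k + 1 := ⟨m - 1, by omega⟩
  have : 0 ≤ t := hw.trans ht.le
  calc w * (t ^ k * Real.exp (-t)) ≤ t * (t ^ k * Real.exp (-t)) := by gcongr
    _ = t ^ (k + 1) * Real.exp (-t) := by ring

lemma tendsto_upperGamma (m : ℕ) : Tendsto (upperGamma m) atTop (𝓝 0) := by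
  have h := intervalIntegral_tendsto_integral_Ioi 0 (integrableOn_pow_mul_exp_neg (m - 1))
    tendsto_id
  have h2 := h.const_sub (upperGamma m 0)
  rw [← upperGamma, sub_self] at h2
  refine h2.congr' ?_
  filter_upwards [eventually_ge_atTop 0] with s hs using (upperGamma_eq_sub m hs).symm

lemma upperGamma_succ {m : ℕ} (hm : 0 < m) {w : ℝ} (hw : 0 ≤ w) :
    upperGamma (m + 1) w = m * upperGamma m w + w ^ m * Real.exp (-w) := by
  obtain ⟨k, rfl⟩ : ∃ k, m = k + 1 := ⟨m - 1, by omega⟩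
  have hi (n : ℕ) : IntegrableOn (fun t : ℝ => t ^ n * Real.exp (-t)) (Ioi w) :=
    (integrableOn_pow_mul_exp_neg n).mono_set (Ioi_subset_Ioi hw)
  have hd (t : ℝ) : HasDerivAt (fun t : ℝ => -(t ^ (k + 1) * Real.exp (-t)))
      (t ^ (k + 1) * Real.exp (-t) - (k + 1) * (t ^ k * Real.exp (-t))) t := by
    have := ((hasDerivAt_pow (k + 1) t).mul ((hasDerivAt_neg t).exp)).neg
    refine this.congr_deriv ?_
    simp; ring
  have ht : Tendsto (fun t : ℝ => -(t ^ (k + 1) * Real.exp (-t))) atTop (𝓝 0) := by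
    simpa using (Real.tendsto_pow_mul_exp_neg_atTop_nhds_zero (k + 1)).neg
  have h := integral_Ioi_of_hasDerivAt_of_tendsto' (fun t (_ : t ∈ Ici w) => hd t)
    ((hi (k + 1)).sub ((hi k).const_mul (k + 1 : ℝ))) ht
  rw [integral_sub (hi (k + 1)) ((hi k).const_mul (k + 1 : ℝ)), integral_const_mul] at h
  simp only [upperGamma, Nat.add_sub_cancel, Nat.cast_add, Nat.cast_one]
  linarith

/-- This is the form in which `g` appears after integrating by parts: the part `w^m e^{-w}` comes
from `t u'`, the part `-Γ(m, w)` from `-u`. -/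
lemma g_eq {m : ℕ} (hm : 0 < m) {w : ℝ} (hw : 0 ≤ w) :
    g m w = w ^ m * Real.exp (-w) - upperGamma m w := by
  rw [g, upperGamma_succ hm hw]; ring

lemma continuousOn_g (m : ℕ) : ContinuousOn (g m) (Ici 0) :=
  (continuousOn_upperGamma _).sub ((continuousOn_upperGamma _).const_smul ((m : ℝ) + 1))

lemma max_g_lt {m : ℕ} (hm : 0 < m) {w : ℝ} (hw : 0 < w) :
    max 0 (g m w) < w ^ m * Real.exp (-w) := by
  refine max_lt (by positivity) ?_
  rw [g_eq hm hw.le]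
  linarith [upperGamma_pos m hw.le]

lemma integrableOn_max_g {m : ℕ} (hm : 0 < m) :
    IntegrableOn (fun w => max 0 (g m w)) (Ioi 0) := by
  refine Integrable.mono' (integrableOn_pow_mul_exp_neg m) ?_ ?_
  · exact ((continuousOn_const.sup ((continuousOn_g m).mono Ioi_subset_Ici_self))
      |>.aestronglyMeasurable measurableSet_Ioi)
  · filter_upwards [ae_restrict_mem measurableSet_Ioi] with w hw
    rw [Real.norm_of_nonneg (le_max_left _ _)]
    exact (max_g_lt hm hw).le

/-- The integrand of `G m` lies strictly below `w^m e^{-w}`, whose integral is `m!`. -/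
lemma G_lt_factorial {m : ℕ} (hm : 0 < m) : G m < m ! := by
  rw [← integral_pow_mul_exp_neg, ← sub_pos, G,
    ← integral_sub (integrableOn_pow_mul_exp_neg m) (integrableOn_max_g hm),
    setIntegral_pos_iff_support_of_nonneg_ae]
  · have : Function.support (fun w : ℝ => w ^ m * Real.exp (-w) - max 0 (g m w)) ∩ Ioi 0
        = Ioi 0 := inter_eq_right.2 fun t ht => (sub_pos.2 (max_g_lt hm ht)).ne'
    simp [this]
  · filter_upwards [ae_restrict_mem measurableSet_Ioi] with w hw
    exact (sub_pos.2 (max_g_lt hm hw)).le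
  · exact (integrableOn_pow_mul_exp_neg m).sub (integrableOn_max_g hm)

/-- Under one integral the integrand is `(t - (m + 1)) t^{m-1} e^{-t}`, positive for `t > w ≥ m +
1`. -/
lemma g_pos {m : ℕ} (hm : 0 < m) {w : ℝ} (hw : (m : ℝ) + 1 ≤ w) : 0 < g m w := by
  have h0 : 0 < w := lt_of_lt_of_le (by positivity) hw
  obtain ⟨k, rfl⟩ : ∃ k, m = k + 1 := ⟨m - 1, by omega⟩
  have hi (n : ℕ) : IntegrableOn (fun t : ℝ => t ^ n * Real.exp (-t)) (Ioi w) :=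
    (integrableOn_pow_mul_exp_neg n).mono_set (Ioi_subset_Ioi h0.le)
  have hp : ∀ t ∈ Ioi w, 0 < t ^ (k + 1) * Real.exp (-t) -
      ((k + 1 : ℕ) + 1) * (t ^ k * Real.exp (-t)) := fun t (ht : w < t) => by
    have h1 : 0 < t := h0.trans ht
    have h2 : 0 < t - ((k + 1 : ℕ) + 1) := by linarith
    have : 0 < (t - ((k + 1 : ℕ) + 1)) * (t ^ k * Real.exp (-t)) := by positivity
    calc _ < _ := this
      _ = _ := by ring
  rw [g, upperGamma, upperGamma]
  simp only [Nat.add_sub_cancel]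
  rw [← integral_const_mul, ← integral_sub (hi (k + 1)) ((hi k).const_mul _),
    setIntegral_pos_iff_support_of_nonneg_ae]
  · refine lt_of_lt_of_le ?_ (measure_mono (s := Ioi w) fun t ht => ⟨(hp t ht).ne', ht⟩)
    simp
  · filter_upwards [ae_restrict_mem measurableSet_Ioi] with t ht using (hp t ht).le
  · exact (hi (k + 1)).sub ((hi k).const_mul _)

lemma G_pos {m : ℕ} (hm : 0 < m) : 0 < G m := by
  rw [G, setIntegral_pos_iff_support_of_nonneg_ae]
  · refine lt_of_lt_of_le ?_ (measure_mono (s := Ioi ((m : ℝ) + 1)) ?_)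
    · simp
    · intro w (hw : (m : ℝ) + 1 < w)
      exact ⟨(lt_max_of_lt_right (g_pos hm hw.le)).ne', lt_trans (by positivity) hw⟩
  · filter_upwards with w using le_max_left _ _
  · exact integrableOn_max_g hm

/-! ### The one-dimensional revenue bound. -/

/-- Integration by parts along a ray, in truncated form. -/
lemma intervalIntegral_virtual_value {m : ℕ} (hm : 0 < m) {u d : ℝ → ℝ} {c R : ℝ} (hR : 0 ≤ R)
    (hu : ContinuousOn u (Ici 0)) (hu0 : u 0 = 0)
    (hd : ∀ t, 0 < t → HasDerivWithinAt u (d t) (Ioi t) t)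
    (hdm : AEMeasurable d (volume.restrict (Ioi 0)))
    (hd0 : ∀ t, 0 < t → 0 ≤ d t) (hdc : ∀ t, 0 < t → d t ≤ c) :
    IntegrableOn (fun t => (t * d t - u t) * (t ^ (m - 1) * Real.exp (-t))) (Ioc 0 R) ∧
    ∫ t in Ioc 0 R, (t * d t - u t) * (t ^ (m - 1) * Real.exp (-t)) ≤
      c * G m + u R * upperGamma m R := by
  have hsub : uIcc 0 R ⊆ Ici 0 := by
    rw [uIcc_of_le hR]; exact Icc_subset_Ici_self
  have hdi : IntervalIntegrable d volume 0 R := by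
    rw [intervalIntegrable_iff_integrableOn_Ioc_of_le hR]
    have hdm' := hdm.mono_measure
      (Measure.restrict_mono (show Ioc 0 R ⊆ Ioi 0 from Ioc_subset_Ioi_self) le_rfl)
    have : IsFiniteMeasure (volume.restrict (Ioc 0 R)) := ⟨by simp⟩
    refine Integrable.of_bound hdm'.aestronglyMeasurable c ?_
    filter_upwards [ae_restrict_mem measurableSet_Ioc] with t ht
    rw [Real.norm_of_nonneg (hd0 t ht.1)]
    exact hdc t ht.1
  have hγ : ContinuousOn (upperGamma m) (uIcc 0 R) := (continuousOn_upperGamma m).mono hsub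
  have hg : ContinuousOn (g m) (uIcc 0 R) := (continuousOn_g m).mono hsub
  have hu' : ContinuousOn u (uIcc 0 R) := hu.mono hsub
  have hk : Continuous fun t : ℝ => t ^ (m - 1) * Real.exp (-t) := by fun_prop
  have h1 : IntervalIntegrable (fun t => d t * upperGamma m t +
      u t * -(t ^ (m - 1) * Real.exp (-t))) volume 0 R :=
    (hdi.mul_continuousOn hγ).add (hu'.mul hk.neg.continuousOn).intervalIntegrable
  have h2 : IntervalIntegrable (fun t => d t * g m t) volume 0 R := hdi.mul_continuousOn hg
  have hftc : ∫ t in (0 : ℝ)..R, (d t * upperGamma m t + u t * -(t ^ (m - 1) * Real.exp (-t)))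
      = u R * upperGamma m R := by
    rw [intervalIntegral.integral_eq_sub_of_hasDeriv_right (f := fun t => u t * upperGamma m t)
      (hu'.mul hγ) ?_ h1, hu0, zero_mul, sub_zero]
    intro t ht
    rw [min_eq_left hR, max_eq_right hR] at ht
    exact (hd t ht.1).mul (hasDerivAt_upperGamma m ht.1).hasDerivWithinAt
  -- The virtual value splits as the derivative of `u · Γ(m, ·)`, which leaves only a boundary term,
  -- plus `d · g(m, ·)`.
  have heq : EqOn (fun t => (d t * upperGamma m t + u t * -(t ^ (m - 1) * Real.exp (-t)))
      + d t * g m t) (fun t => (t * d t - u t) * (t ^ (m - 1) * Real.exp (-t))) (Ioc 0 R) := by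
    intro t ht
    obtain ⟨k, rfl⟩ : ∃ k, m = k + 1 := ⟨m - 1, by omega⟩
    simp only [g_eq hm ht.1.le, Nat.add_sub_cancel]
    ring
  rw [intervalIntegrable_iff_integrableOn_Ioc_of_le hR] at h1 h2
  rw [intervalIntegral.integral_of_le hR] at hftc
  refine ⟨(h1.add h2).congr_fun heq measurableSet_Ioc, ?_⟩
  rw [← setIntegral_congr_fun measurableSet_Ioc heq, integral_add h1 h2, hftc, add_comm, G,
    ← integral_const_mul]
  gcongr ?_ + _
  have hint : IntegrableOn (fun t => c * max 0 (g m t)) (Ioi 0) :=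
    (integrableOn_max_g hm).const_mul c
  have hc : 0 ≤ c := (hd0 1 one_pos).trans (hdc 1 one_pos)
  calc ∫ t in Ioc 0 R, d t * g m t ≤ ∫ t in Ioc 0 R, c * max 0 (g m t) := by
        refine setIntegral_mono_on h2 (hint.mono_set Ioc_subset_Ioi_self) measurableSet_Ioc
          fun t ht => ?_
        calc d t * g m t ≤ d t * max 0 (g m t) :=
              mul_le_mul_of_nonneg_left (le_max_right _ _) (hd0 t ht.1)
          _ ≤ c * max 0 (g m t) := mul_le_mul_of_nonneg_right (hdc t ht.1) (le_max_left _ _)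
    _ ≤ ∫ t in Ioi 0, c * max 0 (g m t) :=
        setIntegral_mono_set hint
          (Eventually.of_forall fun t => mul_nonneg hc (le_max_left _ _))
          (Eventually.of_forall Ioc_subset_Ioi_self)

/-- Revenue bound along a ray: `u` is the utility, `d` its right derivative. -/
lemma lintegral_virtual_value_le {m : ℕ} (hm : 0 < m) {u d : ℝ → ℝ} {c : ℝ}
    (hu : ContinuousOn u (Ici 0)) (hu0 : u 0 = 0)
    (hd : ∀ t, 0 < t → HasDerivWithinAt u (d t) (Ioi t) t)
    (hdm : AEMeasurable d (volume.restrict (Ioi 0)))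
    (hd0 : ∀ t, 0 < t → 0 ≤ d t) (hdc : ∀ t, 0 < t → d t ≤ c)
    (huc : ∀ t, 0 < t → u t ≤ c * t) (hpos : ∀ t, 0 < t → u t ≤ t * d t) :
    ∫⁻ t in Ioi 0, ENNReal.ofReal ((t * d t - u t) * (t ^ (m - 1) * Real.exp (-t))) ≤
      ENNReal.ofReal (c * G m) := by
  have hc : 0 ≤ c := (hd0 1 one_pos).trans (hdc 1 one_pos)
  have hcov : AECover (volume.restrict (Ioi (0 : ℝ))) atTop fun R : ℝ => Iic R :=
    (aecover_Iic tendsto_id).mono Measure.restrict_le_self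
  have hmeas : AEMeasurable (fun t => ENNReal.ofReal ((t * d t - u t) *
      (t ^ (m - 1) * Real.exp (-t)))) (volume.restrict (Ioi 0)) := by
    have := (hu.mono Ioi_subset_Ici_self).aemeasurable measurableSet_Ioi (μ := volume)
    fun_prop
  have hlim : Tendsto (fun R => ENNReal.ofReal (c * G m + c * upperGamma (m + 1) R)) atTop
      (𝓝 (ENNReal.ofReal (c * G m))) := by
    refine ENNReal.tendsto_ofReal ?_
    simpa using ((tendsto_upperGamma (m + 1)).const_mul c).const_add (c * G m)
  refine le_of_tendsto_of_tendsto (hcov.lintegral_tendsto_of_countably_generated hmeas) hlim ?_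
  filter_upwards [eventually_gt_atTop 0] with R hR
  obtain ⟨hi, hle⟩ := intervalIntegral_virtual_value hm hR.le hu hu0 hd hdm hd0 hdc
  rw [Measure.restrict_restrict measurableSet_Iic, inter_comm, Ioi_inter_Iic,
    ← ofReal_integral_eq_lintegral_ofReal hi]
  · refine ENNReal.ofReal_le_ofReal (hle.trans ?_)
    refine add_le_add_right ?_ (c * G m)
    calc u R * upperGamma m R ≤ (c * R) * upperGamma m R :=
          mul_le_mul_of_nonneg_right (huc R hR) (upperGamma_pos m hR.le).le
      _ = c * (R * upperGamma m R) := by ring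
      _ ≤ c * upperGamma (m + 1) R :=
          mul_le_mul_of_nonneg_left (mul_upperGamma_le hm hR.le) hc
  · filter_upwards [ae_restrict_mem measurableSet_Ioc] with t ht
    have h1 : 0 ≤ t * d t - u t := sub_nonneg.2 (hpos t ht.1)
    have h2 : 0 ≤ t := ht.1.le
    simp only [Pi.zero_apply]; positivity

/-! ### Polar coordinates. -/

lemma lintegral_Ioi_comp_mul {b : ℝ} (hb : 0 < b) (f : ℝ → ℝ≥0∞) :
    ∫⁻ t in Ioi 0, f t = ENNReal.ofReal b * ∫⁻ t in Ioi 0, f (b * t) := by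
  have himg : (fun t => b * t) '' Ioi 0 = Ioi 0 := by
    ext t
    constructor
    · rintro ⟨s, hs, rfl⟩
      exact mul_pos hb hs
    · intro ht
      exact ⟨t / b, div_pos ht hb, by field_simp⟩
  have h := lintegral_image_eq_lintegral_abs_deriv_mul (f := fun t => b * t) (f' := fun _ => b)
    measurableSet_Ioi (fun t _ => ((hasDerivAt_const_mul b).hasDerivWithinAt))
    (mul_right_injective₀ hb.ne').injOn f (s := Ioi 0)
  rw [himg, abs_of_pos hb] at h
  rw [h, lintegral_const_mul' _ _ ENNReal.ofReal_ne_top]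

/-- Rescaling the direction multiplies every ray integral by the same factor, so rays can be
compared at any convenient normalisation instead of on the unit sphere. -/
lemma lintegral_ray_smul {E : Type*} [AddCommGroup E] [Module ℝ E] (k : ℕ) (F : E → ℝ≥0∞)
    (x : E) {b : ℝ} (hb : 0 < b) :
    ∫⁻ r in Ioi (0 : ℝ), ENNReal.ofReal (r ^ k) * F (r • x) =
      ENNReal.ofReal (b ^ (k + 1)) *
        ∫⁻ r in Ioi (0 : ℝ), ENNReal.ofReal (r ^ k) * F (r • b • x) := by
  rw [lintegral_Ioi_comp_mul hb, pow_succ', ENNReal.ofReal_mul hb.le, mul_assoc]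
  congr 1
  rw [← lintegral_const_mul' _ _ ENNReal.ofReal_ne_top]
  refine lintegral_congr fun r => ?_
  rw [mul_pow, ENNReal.ofReal_mul (by positivity), smul_smul, mul_assoc, mul_comm r b]

/-- Comparison of integrals in polar coordinates: it is enough to compare along each ray. -/
lemma lintegral_le_of_ray_le {E : Type*} [NormedAddCommGroup E] [NormedSpace ℝ E]
    [MeasurableSpace E] [BorelSpace E] [FiniteDimensional ℝ E] [Nontrivial E]
    (μ : Measure E) [μ.IsAddHaarMeasure] {F H : E → ℝ≥0∞} (hF : Measurable F) (hH : Measurable H)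
    (h : ∀ x : E, x ≠ 0 →
      ∫⁻ r in Ioi (0 : ℝ), ENNReal.ofReal (r ^ (Module.finrank ℝ E - 1)) * F (r • x) ≤
        ∫⁻ r in Ioi (0 : ℝ), ENNReal.ofReal (r ^ (Module.finrank ℝ E - 1)) * H (r • x)) :
    ∫⁻ x, F x ∂μ ≤ ∫⁻ x, H x ∂μ := by
  have key (K : E → ℝ≥0∞) (hK : Measurable K) : ∫⁻ x, K x ∂μ =
      ∫⁻ θ : Metric.sphere (0 : E) 1, (∫⁻ r in Ioi (0 : ℝ),
        ENNReal.ofReal (r ^ (Module.finrank ℝ E - 1)) * K (r • (θ : E))) ∂μ.toSphere := by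
    have hm : Measurable fun p : Metric.sphere (0 : E) 1 × Ioi (0 : ℝ) =>
        K ((p.2 : ℝ) • (p.1 : E)) := by fun_prop
    calc ∫⁻ x, K x ∂μ = ∫⁻ x : ({(0)}ᶜ : Set E), K x ∂(μ.comap (↑)) := by
          rw [lintegral_subtype_comap (measurableSet_singleton _).compl, restrict_compl_singleton]
      _ = ∫⁻ p, K ((p.2 : ℝ) • (p.1 : E))
            ∂μ.toSphere.prod (.volumeIoiPow (Module.finrank ℝ E - 1)) := by
          rw [← μ.measurePreserving_homeomorphUnitSphereProd.lintegral_comp hm]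
          refine lintegral_congr fun x => ?_
          rw [← homeomorphUnitSphereProd_symm_apply_coe, Homeomorph.symm_apply_apply]
      _ = _ := by
          rw [lintegral_prod _ hm.aemeasurable]
          refine lintegral_congr fun θ => ?_
          rw [Measure.volumeIoiPow, lintegral_withDensity_eq_lintegral_mul _ (by fun_prop)
            (by fun_prop), ← lintegral_subtype_comap measurableSet_Ioi]
          rfl
  rw [key F hF, key H hH]
  refine lintegral_mono fun θ => h θ ?_
  exact ne_zero_of_mem_unit_sphere θ

/-! ### Exponential laws and their products. -/

/-- The product of measures with densities on `ℝ`. -/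
lemma pi_withDensity_ofReal {ι : Type*} [Fintype ι] {f : ι → ℝ → ℝ}
    (hf : ∀ j x, 0 ≤ f j x) (hi : ∀ j, Integrable (f j)) :
    Measure.pi (fun j => (volume : Measure ℝ).withDensity fun x => ENNReal.ofReal (f j x)) =
      (volume : Measure (ι → ℝ)).withDensity fun x => ∏ j, ENNReal.ofReal (f j (x j)) := by
  have : ∀ j, SigmaFinite ((volume : Measure ℝ).withDensity fun x => ENNReal.ofReal (f j x)) :=
    fun j => SigmaFinite.withDensity_ofReal _
  refine Measure.pi_eq fun s hs => ?_
  have hi' (j : ι) : Integrable ((s j).indicator (f j)) := (hi j).indicator (hs j)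
  have h0 (j : ι) (x : ℝ) : 0 ≤ (s j).indicator (f j) x := indicator_nonneg (fun x _ => hf j x) x
  calc _ = ∫⁻ x : ι → ℝ, ENNReal.ofReal (∏ j, (s j).indicator (f j) (x j)) := by
        rw [withDensity_apply _ (MeasurableSet.univ_pi hs),
          ← lintegral_indicator (MeasurableSet.univ_pi hs)]
        refine lintegral_congr fun x => ?_
        by_cases hx : x ∈ univ.pi s
        · rw [indicator_of_mem hx, ENNReal.ofReal_prod_of_nonneg fun j _ => h0 j _]
          exact Finset.prod_congr rfl fun j _ => by rw [indicator_of_mem (hx j trivial)]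
        · rw [indicator_of_notMem hx]
          simp only [mem_univ_pi, not_forall] at hx
          obtain ⟨j, hj⟩ := hx
          rw [Finset.prod_eq_zero (Finset.mem_univ j) (indicator_of_notMem hj _),
            ENNReal.ofReal_zero]
    _ = ENNReal.ofReal (∏ j, ∫ x, (s j).indicator (f j) x) := by
        rw [← integral_fintype_prod_volume_eq_prod, volume_pi,
          ofReal_integral_eq_lintegral_ofReal (Integrable.fintype_prod hi')]
        exact Eventually.of_forall fun x => Finset.prod_nonneg fun j _ => h0 j _
    _ = _ := by
        rw [ENNReal.ofReal_prod_of_nonneg fun j _ => integral_nonneg (h0 j)]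
        refine Finset.prod_congr rfl fun j _ => ?_
        rw [integral_indicator (hs j), withDensity_apply _ (hs j),
          ofReal_integral_eq_lintegral_ofReal (hi j).integrableOn
          (Eventually.of_forall (hf j))]

lemma integrable_exponentialPDFReal {r : ℝ} (hr : 0 < r) : Integrable (exponentialPDFReal r) := by
  refine ⟨(measurable_exponentialPDFReal r).aestronglyMeasurable, ?_⟩
  rw [hasFiniteIntegral_iff_ofReal (Eventually.of_forall (exponentialPDFReal_nonneg hr))]
  exact (lintegral_exponentialPDF_eq_one hr).trans_lt ENNReal.one_lt_top

lemma pi_expMeasure {ι : Type*} [Fintype ι] {lam : ι → ℝ} (hlam : ∀ j, 0 < lam j) :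
    Measure.pi (fun j => expMeasure (lam j)) =
      (volume : Measure (ι → ℝ)).withDensity fun x => ∏ j, exponentialPDF (lam j) (x j) :=
  pi_withDensity_ofReal (fun j => exponentialPDFReal_nonneg (hlam j))
    (fun j => integrable_exponentialPDFReal (hlam j))

lemma prod_exponentialPDF {ι : Type*} [Fintype ι] {lam : ι → ℝ} (hlam : ∀ j, 0 < lam j)
    {x : ι → ℝ} (hx : 0 ≤ x) :
    ∏ j, exponentialPDF (lam j) (x j) =
      ENNReal.ofReal ((∏ j, lam j) * Real.exp (-∑ j, lam j * x j)) := by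
  rw [← Finset.sum_neg_distrib, Real.exp_sum, ← Finset.prod_mul_distrib,
    ENNReal.ofReal_prod_of_nonneg fun j _ => mul_nonneg (hlam j).le (Real.exp_pos _).le]
  exact Finset.prod_congr rfl fun j _ => exponentialPDF_of_nonneg (hx j)

lemma lintegral_ofReal_expMeasure {r : ℝ} (hr : 0 < r) :
    ∫⁻ x, ENNReal.ofReal x ∂expMeasure r = ENNReal.ofReal (1 / r) := by
  have hgamma := Real.integral_rpow_mul_exp_neg_mul_Ioi (a := 2) two_pos hr
  have hint : IntegrableOn (fun t : ℝ => r * (t ^ ((2 : ℝ) - 1) * Real.exp (-(r * t)))) (Ioi 0) := by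
    refine Integrable.const_mul ?_ r
    have := integrableOn_rpow_mul_exp_neg_mul_rpow (p := 1) (s := 1) (b := r) (by norm_num)
      one_pos hr
    refine IntegrableOn.congr_fun this (fun t _ => ?_) measurableSet_Ioi
    norm_num
  calc ∫⁻ x, ENNReal.ofReal x ∂expMeasure r
      = ∫⁻ x, exponentialPDF r x * ENNReal.ofReal x := by
        rw [expMeasure, gammaMeasure, lintegral_withDensity_eq_lintegral_mul _
          (f := gammaPDF 1 r) (measurable_exponentialPDFReal r).ennreal_ofReal (by fun_prop)]
        rfl
    _ = ∫⁻ x in Ioi 0, exponentialPDF r x * ENNReal.ofReal x := by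
        rw [← lintegral_indicator measurableSet_Ioi]
        refine lintegral_congr fun x => ?_
        by_cases hx : x ∈ Ioi (0 : ℝ)
        · rw [indicator_of_mem hx]
        · rw [indicator_of_notMem hx, ENNReal.ofReal_of_nonpos (not_lt.1 hx), mul_zero]
    _ = ∫⁻ x in Ioi 0, ENNReal.ofReal (r * (x ^ ((2 : ℝ) - 1) * Real.exp (-(r * x)))) := by
        refine setLIntegral_congr_fun measurableSet_Ioi fun x (hx : 0 < x) => ?_
        rw [exponentialPDF_of_nonneg hx.le, ← ENNReal.ofReal_mul (by positivity)]
        congr 1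
        norm_num
        ring
    _ = ENNReal.ofReal (1 / r) := by
        rw [← ofReal_integral_eq_lintegral_ofReal hint, integral_const_mul, hgamma]
        · congr 1
          rw [Real.Gamma_two, Real.rpow_two]; field_simp
        · filter_upwards [ae_restrict_mem measurableSet_Ioi] with x (hx : 0 < x)
          simp only [Pi.zero_apply]; positivity

lemma expMeasure_Ioi {r t : ℝ} (hr : 0 < r) (ht : 0 ≤ t) :
    expMeasure r (Ioi t) = ENNReal.ofReal (Real.exp (-(r * t))) := by
  have := isProbabilityMeasure_expMeasure hr
  have h : (expMeasure r).real (Iic t) = 1 - Real.exp (-(r * t)) := by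
    rw [← cdf_eq_real, cdf_expMeasure_eq hr, if_pos ht]
  rw [← compl_Iic, ← ofReal_measureReal (measure_ne_top _ _),
    probReal_compl_eq_one_sub measurableSet_Iic, h, sub_sub_cancel]

/-! ### Convex utilities on a half-line. -/

section Ray

variable {u q : ℝ → ℝ} {c : ℝ}

lemma convexOn_of_subgradient (h : ∀ s, 0 ≤ s → ∀ t, 0 ≤ t → u s + q s * (t - s) ≤ u t) :
    ConvexOn ℝ (Ici 0) u := by
  refine ⟨convex_Ici 0, fun x hx y hy a b ha hb hab => ?_⟩
  have hz : 0 ≤ a * x + b * y := add_nonneg (mul_nonneg ha hx) (mul_nonneg hb hy)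
  have h1 := mul_le_mul_of_nonneg_left (h _ hz x hx) ha
  have h2 := mul_le_mul_of_nonneg_left (h _ hz y hy) hb
  simp only [smul_eq_mul]
  obtain rfl : a = 1 - b := by linarith
  linarith

/-- Revenue bound along a ray for a one-dimensional utility `u` with subgradient `q`. -/
lemma lintegral_ray_le {m : ℕ} (hm : 0 < m)
    (h : ∀ s, 0 ≤ s → ∀ t, 0 ≤ t → u s + q s * (t - s) ≤ u t) (hu0 : u 0 = 0)
    (hq0 : ∀ t, 0 ≤ t → 0 ≤ q t) (hqc : ∀ t, 0 ≤ t → q t ≤ c) :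
    (∀ t, 0 < t → HasDerivWithinAt u (derivWithin u (Ioi t) t) (Ioi t) t) ∧
    ∫⁻ t in Ioi 0, ENNReal.ofReal
        ((t * derivWithin u (Ioi t) t - u t) * (t ^ (m - 1) * Real.exp (-t))) ≤
      ENNReal.ofReal (c * G m) := by
  have hconv := convexOn_of_subgradient h
  have hc : 0 ≤ c := (hq0 0 le_rfl).trans (hqc 0 le_rfl)
  have hup : ∀ s, 0 ≤ s → ∀ t, 0 ≤ t → u t - u s ≤ c * |t - s| := fun s hs t ht => by
    have h1 := h t ht s hs
    have h2 : q t * (t - s) ≤ c * |t - s| :=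
      (mul_le_mul_of_nonneg_left (le_abs_self _) (hq0 t ht)).trans
        (mul_le_mul_of_nonneg_right (hqc t ht) (abs_nonneg _))
    linarith
  -- Convexity alone gives no continuity at the endpoint 0; the slope bound does.
  have hcont : ContinuousOn u (Ici 0) := by
    refine (LipschitzOnWith.of_le_add_mul (K := ⟨c, hc⟩) ?_).continuousOn
    intro x hx y hy
    have := hup y hy x hx
    rw [Real.dist_eq]
    exact sub_le_iff_le_add'.1 this
  have hd : ∀ t, 0 < t → HasDerivWithinAt u (derivWithin u (Ioi t) t) (Ioi t) t := fun t ht =>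
    hconv.hasDerivWithinAt_rightDeriv_of_mem_interior (by rwa [interior_Ici])
  -- Any subgradient is at most the right derivative, so passing to the latter can only raise `t d -
  -- u`.
  have hqd : ∀ t, 0 < t → q t ≤ derivWithin u (Ioi t) t := fun t ht => by
    refine ge_of_tendsto (hasDerivWithinAt_iff_tendsto_slope' self_notMem_Ioi |>.1 (hd t ht)) ?_
    filter_upwards [self_mem_nhdsWithin] with y (hy : t < y)
    rw [slope_def_field, le_div_iff₀ (sub_pos.2 hy)]
    linarith [h t ht.le y (ht.trans hy).le]
  have hdc : ∀ t, 0 < t → derivWithin u (Ioi t) t ≤ c := fun t ht => by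
    refine le_of_tendsto (hasDerivWithinAt_iff_tendsto_slope' self_notMem_Ioi |>.1 (hd t ht)) ?_
    filter_upwards [self_mem_nhdsWithin] with y (hy : t < y)
    rw [slope_def_field, div_le_iff₀ (sub_pos.2 hy)]
    have := hup t ht.le y (ht.trans hy).le
    rwa [abs_of_pos (sub_pos.2 hy)] at this
  have hmono : MonotoneOn (fun t => derivWithin u (Ioi t) t) (Ioi 0) := by
    have := hconv.monotoneOn_rightDeriv
    rwa [interior_Ici] at this
  refine ⟨hd, lintegral_virtual_value_le hm hcont hu0 hd
    (aemeasurable_restrict_of_monotoneOn measurableSet_Ioi hmono)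
    (fun t ht => (hq0 t ht.le).trans (hqd t ht)) hdc (fun t ht => ?_) fun t ht => ?_⟩
  · have := hup 0 le_rfl t ht.le
    rwa [hu0, sub_zero, sub_zero, abs_of_pos ht] at this
  · have h1 := h t ht.le 0 le_rfl
    have h2 := mul_le_mul_of_nonneg_left (hqd t ht) ht.le
    rw [hu0] at h1
    linarith

end Ray

/-! ### Truthful utility and a measurable majorant of the payment. -/

section Mechanism

variable {ι : Type*} [Fintype ι] {M : Mechanism ι}

lemma Mechanism.IC.subgradient (hM : M.IC) {x y : ι → ℝ} (hx : 0 ≤ x) (hy : 0 ≤ y) :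
    M.utility x x + ∑ j, M.alloc x j * (y j - x j) ≤ M.utility y y := by
  refine le_of_eq_of_le ?_ (hM y hy x hx)
  simp only [Mechanism.utility, mul_sub, Finset.sum_sub_distrib]
  ring

/-- At the origin the utility is minus a nonnegative payment, and IR makes it nonnegative. -/
lemma Mechanism.IR.utility_zero (hM : M.IR) : M.utility 0 0 = 0 := by
  refine le_antisymm ?_ (hM 0 self_mem_Ici)
  have := M.payment_nonneg 0 self_mem_Ici
  simpa [Mechanism.utility] using this

/-- The truthful utility, extended from the orthant to the whole space. -/
noncomputable def Mechanism.truthfulUtility (M : Mechanism ι) (x : ι → ℝ) : ℝ :=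
  M.utility (x ⊔ 0) (x ⊔ 0)

lemma Mechanism.truthfulUtility_of_nonneg (M : Mechanism ι) {x : ι → ℝ} (hx : 0 ≤ x) :
    M.truthfulUtility x = M.utility x x := by
  rw [truthfulUtility, sup_of_le_left hx]

lemma Mechanism.IC.continuous_truthfulUtility (hM : M.IC) : Continuous M.truthfulUtility := by
  refine (LipschitzWith.of_le_add_mul (Fintype.card ι) fun x y => ?_).continuous
  have h := hM.subgradient (x := x ⊔ 0) (y := y ⊔ 0) le_sup_right le_sup_right
  have hsum : ∑ j, M.alloc (x ⊔ 0) j * ((x ⊔ 0) j - (y ⊔ 0) j) ≤ Fintype.card ι * dist x y := by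
    rw [← nsmul_eq_mul, ← Finset.card_univ]
    refine Finset.sum_le_card_nsmul _ _ _ fun j _ => ?_
    obtain ⟨h0, h1⟩ := M.alloc_mem (x ⊔ 0) (mem_Ici.2 le_sup_right) j
    calc M.alloc (x ⊔ 0) j * ((x ⊔ 0) j - (y ⊔ 0) j)
        ≤ 1 * |(x ⊔ 0) j - (y ⊔ 0) j| :=
          (mul_le_mul_of_nonneg_left (le_abs_self _) h0).trans
            (mul_le_mul_of_nonneg_right h1 (abs_nonneg _))
      _ ≤ |x j - y j| := by
          rw [one_mul]; exact abs_max_sub_max_le_abs (x j) (y j) 0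
      _ ≤ dist x y := by
          rw [← Real.dist_eq]; exact dist_le_pi_dist x y j
  simp only [mul_sub, Finset.sum_sub_distrib] at h hsum
  simp only [truthfulUtility, NNReal.coe_natCast]
  linarith

/-- A measurable majorant of the payment of an IC mechanism:
the radial derivative of the utility minus the utility. -/
noncomputable def Mechanism.virtualPayment (M : Mechanism ι) (x : ι → ℝ) : ℝ :=
  (⨅ n : ℕ, ((n : ℝ) + 1) *
    (M.truthfulUtility ((1 + ((n : ℝ) + 1)⁻¹) • x) - M.truthfulUtility x)) - M.truthfulUtility x

lemma Mechanism.IC.measurable_virtualPayment (hM : M.IC) : Measurable M.virtualPayment := by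
  have := hM.continuous_truthfulUtility.measurable
  unfold virtualPayment
  refine Measurable.sub (Measurable.iInf fun n => ?_) this
  fun_prop

/-- The subgradient inequality at `x`, tested at a dilation of `x`. It also bounds the infimum in
`virtualPayment` from below, without which a real `⨅` would take its default value. -/
lemma Mechanism.IC.dot_le_difference (hM : M.IC) {x : ι → ℝ} (hx : 0 ≤ x) (n : ℕ) :
    ∑ j, M.alloc x j * x j ≤ ((n : ℝ) + 1) *
      (M.truthfulUtility ((1 + ((n : ℝ) + 1)⁻¹) • x) - M.truthfulUtility x) := by
  have hn : (0 : ℝ) < (n : ℝ) + 1 := by positivity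
  have hx' : 0 ≤ (1 + ((n : ℝ) + 1)⁻¹) • x := smul_nonneg (by positivity) hx
  rw [M.truthfulUtility_of_nonneg hx, M.truthfulUtility_of_nonneg hx']
  have h := hM.subgradient hx hx'
  have h2 : ∑ j, M.alloc x j * (((1 + ((n : ℝ) + 1)⁻¹) • x) j - x j) =
      ((n : ℝ) + 1)⁻¹ * ∑ j, M.alloc x j * x j := by
    rw [Finset.mul_sum]
    refine Finset.sum_congr rfl fun j _ => ?_
    simp only [Pi.smul_apply, smul_eq_mul]; ring
  rw [h2, ← le_sub_iff_add_le', inv_mul_le_iff₀ hn] at h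
  exact h

lemma Mechanism.IC.payment_le_virtualPayment (hM : M.IC) {x : ι → ℝ} (hx : 0 ≤ x) :
    M.payment x ≤ M.virtualPayment x := by
  have h := le_ciInf (hM.dot_le_difference hx)
  have h2 : M.utility x x = ∑ j, M.alloc x j * x j - M.payment x := rfl
  rw [virtualPayment, M.truthfulUtility_of_nonneg hx] at *
  linarith

/-- The radial difference quotients in the infimum converge to `t * d`, so the infimum cannot exceed
this limit. -/
lemma Mechanism.IC.virtualPayment_smul_le (hM : M.IC) {x : ι → ℝ} (hx : 0 ≤ x) {t d : ℝ}
    (ht : 0 < t) (hd : HasDerivWithinAt (fun s : ℝ => M.utility (s • x) (s • x)) d (Ioi t) t) :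
    M.virtualPayment (t • x) ≤ t * d - M.utility (t • x) (t • x) := by
  have htx : 0 ≤ t • x := smul_nonneg ht.le hx
  rw [virtualPayment, ← M.truthfulUtility_of_nonneg htx]
  refine sub_le_sub_right ?_ _
  have hseq : Tendsto (fun n : ℕ => (1 + ((n : ℝ) + 1)⁻¹) * t) atTop (𝓝[>] t) := by
    refine tendsto_nhdsWithin_iff.2 ⟨?_, Eventually.of_forall fun n => ?_⟩
    · have h := (tendsto_one_div_add_atTop_nhds_zero_nat (𝕜 := ℝ)).const_add 1 |>.mul_const t
      simpa only [one_div, add_zero, one_mul] using h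
    · have : 0 < ((n : ℝ) + 1)⁻¹ * t := by positivity
      simp only [mem_Ioi]; linarith
  have hlim := ((hasDerivWithinAt_iff_tendsto_slope' self_notMem_Ioi).1 hd).comp hseq
    |>.const_mul t
  refine ge_of_tendsto hlim (Eventually.of_forall fun n => ?_)
  refine (ciInf_le ⟨_, forall_mem_range.2 (hM.dot_le_difference htx)⟩ n).trans_eq ?_
  have hx' : 0 ≤ (1 + ((n : ℝ) + 1)⁻¹) • t • x := smul_nonneg (by positivity) htx
  rw [M.truthfulUtility_of_nonneg htx, M.truthfulUtility_of_nonneg hx', Function.comp_apply,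
    slope_def_field, smul_smul]
  have : (1 + ((n : ℝ) + 1)⁻¹) * t - t = ((n : ℝ) + 1)⁻¹ * t := by ring
  rw [this]
  field_simp

lemma Mechanism.lintegral_virtualPayment_ray_le {m : ℕ} (hm : 0 < m) (hIR : M.IR) (hIC : M.IC)
    {x : ι → ℝ} (hx : 0 ≤ x) :
    ∫⁻ t in Ioi 0, ENNReal.ofReal (M.virtualPayment (t • x)) *
      ENNReal.ofReal (t ^ (m - 1) * Real.exp (-t)) ≤ ENNReal.ofReal ((∑ j, x j) * G m) := by
  obtain ⟨hd, hle⟩ : _ ∧ _ :=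
    lintegral_ray_le hm (u := fun t => M.utility (t • x) (t • x))
      (q := fun t => ∑ j, M.alloc (t • x) j * x j) (c := ∑ j, x j)
      (fun s hs t ht => by
        refine le_of_eq_of_le ?_
          (hIC.subgradient (smul_nonneg hs hx) (smul_nonneg ht hx))
        rw [Finset.sum_mul]
        refine congrArg _ (Finset.sum_congr rfl fun j _ => ?_)
        simp only [Pi.smul_apply, smul_eq_mul]; ring)
      (by simpa using hIR.utility_zero)
      (fun t ht => Finset.sum_nonneg fun j _ =>
        mul_nonneg (M.alloc_mem _ (smul_nonneg ht hx) j).1 (hx j))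
      (fun t ht => Finset.sum_le_sum fun j _ =>
        mul_le_of_le_one_left (hx j) (M.alloc_mem _ (smul_nonneg ht hx) j).2)
  refine le_trans (setLIntegral_mono' measurableSet_Ioi fun t (ht : 0 < t) => ?_) hle
  rw [← ENNReal.ofReal_mul' (by positivity)]
  exact ENNReal.ofReal_le_ofReal (mul_le_mul_of_nonneg_right
    (hIC.virtualPayment_smul_le hx ht (hd t ht)) (by positivity))

end Mechanism

/-! ### Upper bound for the revenue of the bundle of goods. -/

lemma Mechanism.ray_comparison {m : ℕ} (hm : 0 < m) {lam : Fin m → ℝ} (hlam : ∀ j, 0 < lam j)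
    {M : Mechanism (Fin m)} (hIR : M.IR) (hIC : M.IC) {y : Fin m → ℝ} (hy : 0 ≤ y)
    (hy1 : ∑ j, lam j * y j = 1) :
    ∫⁻ r in Ioi (0 : ℝ), ENNReal.ofReal (r ^ (m - 1)) *
      ((∏ j, exponentialPDF (lam j) ((r • y) j)) * ENNReal.ofReal (M.virtualPayment (r • y))) ≤
    ∫⁻ r in Ioi (0 : ℝ), ENNReal.ofReal (r ^ (m - 1)) *
      ((∏ j, exponentialPDF (lam j) ((r • y) j)) *
        (ENNReal.ofReal (G m / m !) * ∑ j, ENNReal.ofReal ((r • y) j))) := by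
  have hprod : 0 ≤ ∏ j, lam j := Finset.prod_nonneg fun j _ => (hlam j).le
  have hsum : 0 ≤ ∑ j, y j := Finset.sum_nonneg fun j _ => hy j
  have hG := (G_pos hm).le
  have hpdf {r : ℝ} (hr : 0 < r) : ∏ j, exponentialPDF (lam j) ((r • y) j) =
      ENNReal.ofReal (∏ j, lam j) * ENNReal.ofReal (Real.exp (-r)) := by
    have h : ∑ j, lam j * (r • y) j = r := by
      calc _ = r * ∑ j, lam j * y j := by
            rw [Finset.mul_sum]
            refine Finset.sum_congr rfl fun j _ => ?_
            simp only [Pi.smul_apply, smul_eq_mul]; ring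
        _ = r := by rw [hy1, mul_one]
    rw [prod_exponentialPDF hlam (smul_nonneg hr.le hy), ENNReal.ofReal_mul hprod, h]
  calc _ = ∫⁻ r in Ioi (0 : ℝ), ENNReal.ofReal (∏ j, lam j) *
        (ENNReal.ofReal (M.virtualPayment (r • y)) *
          ENNReal.ofReal (r ^ (m - 1) * Real.exp (-r))) := by
        refine setLIntegral_congr_fun measurableSet_Ioi fun r (hr : 0 < r) => ?_
        rw [hpdf hr, ENNReal.ofReal_mul (by positivity)]
        ring
    _ ≤ ENNReal.ofReal (∏ j, lam j) * ENNReal.ofReal ((∑ j, y j) * G m) := by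
        rw [lintegral_const_mul' _ _ ENNReal.ofReal_ne_top]
        gcongr
        exact M.lintegral_virtualPayment_ray_le hm hIR hIC hy
    -- Write `G m` as `(G m / m!) · ∫ r^m e^{-r}`; the extra factor `r` beyond the polar weight
    -- turns `∑ y_j` into the sum of the values at `r • y`.
    _ = ENNReal.ofReal ((∏ j, lam j) * ((G m / m !) * (∑ j, y j))) *
          ∫⁻ r in Ioi (0 : ℝ), ENNReal.ofReal (r ^ m * Real.exp (-r)) := by
        rw [← ofReal_integral_eq_lintegral_ofReal (integrableOn_pow_mul_exp_neg m),
          integral_pow_mul_exp_neg, ← ENNReal.ofReal_mul hprod, ← ENNReal.ofReal_mul (by positivity)]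
        · congr 1
          field_simp
        · filter_upwards [ae_restrict_mem measurableSet_Ioi] with r (hr : 0 < r)
          simp only [Pi.zero_apply]; positivity
    _ = _ := by
        rw [← lintegral_const_mul' _ _ ENNReal.ofReal_ne_top]
        refine setLIntegral_congr_fun measurableSet_Ioi fun r (hr : 0 < r) => ?_
        have hs : ∑ j, ENNReal.ofReal ((r • y) j) = ENNReal.ofReal (r * ∑ j, y j) := by
          rw [Finset.mul_sum, ENNReal.ofReal_sum_of_nonneg fun j _ => mul_nonneg hr.le (hy j)]
          rfl
        rw [hpdf hr, hs, ← ENNReal.ofReal_mul hprod, ← ENNReal.ofReal_mul (by positivity),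
          ← ENNReal.ofReal_mul (by positivity), ← ENNReal.ofReal_mul (by positivity),
          ← ENNReal.ofReal_mul (by positivity)]
        obtain ⟨k, rfl⟩ : ∃ k, m = k + 1 := ⟨m - 1, by omega⟩
        congr 1
        simp only [Nat.add_sub_cancel]
        ring

lemma lintegral_sum_ofReal_pi_expMeasure {ι : Type*} [Fintype ι] {lam : ι → ℝ}
    (hlam : ∀ j, 0 < lam j) :
    ∫⁻ x, ∑ j, ENNReal.ofReal (x j) ∂Measure.pi (fun j => expMeasure (lam j)) =
      ∑ j, ENNReal.ofReal (1 / lam j) := by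
  have (j : ι) : IsProbabilityMeasure (expMeasure (lam j)) :=
    isProbabilityMeasure_expMeasure (hlam j)
  rw [lintegral_finsetSum _ fun j _ => by fun_prop]
  refine Finset.sum_congr rfl fun j _ => ?_
  rw [← lintegral_ofReal_expMeasure (hlam j)]
  exact (measurePreserving_eval (fun j => expMeasure (lam j)) j).lintegral_comp
    ENNReal.measurable_ofReal

lemma Rev_pi_expMeasure_le {m : ℕ} (hm : 0 < m) {lam : Fin m → ℝ} (hlam : ∀ j, 0 < lam j) :
    Rev (Measure.pi fun j => expMeasure (lam j)) ≤
      ENNReal.ofReal (G m / m !) * ∑ j, ENNReal.ofReal (1 / lam j) := by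
  refine iSup_le fun M => iSup_le fun hIR => iSup_le fun hIC => ?_
  have : Nonempty (Fin m) := ⟨⟨0, hm⟩⟩
  have hpdf : Measurable fun x : Fin m → ℝ => ∏ j, exponentialPDF (lam j) (x j) :=
    Finset.measurable_prod _ fun j _ =>
      (measurable_exponentialPDFReal _).ennreal_ofReal.comp (measurable_pi_apply j)
  have hP : Measurable fun x => ENNReal.ofReal (M.virtualPayment x) :=
    hIC.measurable_virtualPayment.ennreal_ofReal
  have hS : Measurable fun x : Fin m → ℝ =>
      ENNReal.ofReal (G m / m !) * ∑ j, ENNReal.ofReal (x j) := by fun_prop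
  calc M.revenue (Measure.pi fun j => expMeasure (lam j))
      ≤ ∫⁻ x in Ici 0, ENNReal.ofReal (M.virtualPayment x)
          ∂Measure.pi fun j => expMeasure (lam j) :=
        setLIntegral_mono' measurableSet_Ici fun x hx =>
          ENNReal.ofReal_le_ofReal (hIC.payment_le_virtualPayment hx)
    _ ≤ ∫⁻ x, ENNReal.ofReal (M.virtualPayment x) ∂Measure.pi fun j => expMeasure (lam j) :=
        setLIntegral_le_lintegral _ _
    _ ≤ ∫⁻ x, ENNReal.ofReal (G m / m !) * ∑ j, ENNReal.ofReal (x j)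
          ∂Measure.pi fun j => expMeasure (lam j) := by
        rw [pi_expMeasure hlam, lintegral_withDensity_eq_lintegral_mul _ hpdf hP,
          lintegral_withDensity_eq_lintegral_mul _ hpdf hS]
        refine lintegral_le_of_ray_le volume (hpdf.mul hP) (hpdf.mul hS) fun x hx => ?_
        simp only [Module.finrank_fin_fun, Pi.mul_apply]
        by_cases hx0 : 0 ≤ x
        · have hs : 0 < ∑ j, lam j * x j := by
            obtain ⟨j, hj⟩ : ∃ j, x j ≠ 0 := Function.ne_iff.1 hx
            exact Finset.sum_pos' (fun i _ => mul_nonneg (hlam i).le (hx0 i))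
              ⟨j, Finset.mem_univ j, mul_pos (hlam j) ((hx0 j).lt_of_ne' hj)⟩
          -- Normalise the ray so that `∑ λ_j y_j = 1`.
          set b := (∑ j, lam j * x j)⁻¹ with hb
          have hb0 : 0 < b := inv_pos.2 hs
          rw [lintegral_ray_smul (m - 1) (fun x => (∏ j, exponentialPDF (lam j) (x j)) *
              ENNReal.ofReal (M.virtualPayment x)) x hb0,
            lintegral_ray_smul (m - 1) (fun x => (∏ j, exponentialPDF (lam j) (x j)) *
              (ENNReal.ofReal (G m / m !) * ∑ j, ENNReal.ofReal (x j))) x hb0]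
          refine mul_le_mul_right (M.ray_comparison hm hlam hIR hIC
            (smul_nonneg hb0.le hx0) ?_) _
          simp only [Pi.smul_apply, smul_eq_mul, mul_left_comm _ b, ← Finset.mul_sum]
          exact inv_mul_cancel₀ hs.ne'
        -- Rays leaving the orthant carry zero density.
        · obtain ⟨j, hj⟩ : ∃ j, x j < 0 := by
            simpa [Pi.le_def] using hx0
          refine le_of_eq_of_le ?_ zero_le
          refine (setLIntegral_congr_fun measurableSet_Ioi fun r (hr : 0 < r) => ?_).trans
            lintegral_zero
          rw [Finset.prod_eq_zero (Finset.mem_univ j), zero_mul, mul_zero]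
          exact exponentialPDF_of_neg (mul_neg_of_pos_of_neg hr hj)
    _ = _ := by
        rw [lintegral_const_mul' _ _ ENNReal.ofReal_ne_top,
          lintegral_sum_ofReal_pi_expMeasure hlam]

/-! ### Separate sales: finiteness and posted prices. -/

/-- By IR a buyer never pays more than the total value; this serves only to make `SRev` finite. -/
lemma Rev_le_lintegral_sum {ι : Type*} [Fintype ι] (F : Measure (ι → ℝ)) :
    Rev F ≤ ∫⁻ x, ∑ j, ENNReal.ofReal (x j) ∂F := by
  refine iSup_le fun M => iSup_le fun hIR => iSup_le fun _ => ?_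
  refine (setLIntegral_mono' measurableSet_Ici fun x hx => ?_).trans
    (setLIntegral_le_lintegral (Ici 0) _)
  rw [← ENNReal.ofReal_sum_of_nonneg fun j _ => hx j]
  refine ENNReal.ofReal_le_ofReal ?_
  have h1 := hIR x hx
  have h2 : ∑ j, M.alloc x j * x j ≤ ∑ j, x j := Finset.sum_le_sum fun j _ =>
    mul_le_of_le_one_left (hx j) (M.alloc_mem x hx j).2
  simp only [Mechanism.utility] at h1
  linarith

open Classical in
/-- Selling a single good at a posted price. -/
noncomputable def postedPrice (p : ℝ) (hp : 0 ≤ p) : Mechanism Unit where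
  alloc x _ := if p ≤ x () then 1 else 0
  payment x := if p ≤ x () then p else 0
  alloc_mem x _ _ := by split_ifs <;> simp
  payment_nonneg x _ := by split_ifs <;> simp [hp]

lemma postedPrice_IR (p : ℝ) (hp : 0 ≤ p) : (postedPrice p hp).IR := by
  intro x _
  simp only [Mechanism.utility, postedPrice, Finset.univ_unique, Finset.sum_singleton]
  split_ifs with h
  · simpa using h
  · simp

lemma postedPrice_IC (p : ℝ) (hp : 0 ≤ p) : (postedPrice p hp).IC := by
  intro x _ x' _
  simp only [Mechanism.utility, postedPrice, Finset.univ_unique, Finset.sum_singleton]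
  change (if p ≤ x' () then (1 : ℝ) else 0) * x () - (if p ≤ x' () then p else 0) ≤
    (if p ≤ x () then (1 : ℝ) else 0) * x () - (if p ≤ x () then p else 0)
  split_ifs <;> linarith

/-- The price `1 / r` maximises `p e^{-rp}` and sells with probability `e^{-1}`. -/
lemma le_Rev_expMeasure {r : ℝ} (hr : 0 < r) :
    ENNReal.ofReal (1 / r) * ENNReal.ofReal (Real.exp (-1)) ≤
      Rev (Measure.pi fun _ : Unit => expMeasure r) := by
  have := isProbabilityMeasure_expMeasure hr
  have hp : 0 ≤ 1 / r := by positivity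
  refine le_trans ?_ (le_iSup_of_le (postedPrice (1 / r) hp) (le_iSup_of_le
    (postedPrice_IR _ hp) (le_iSup_of_le (postedPrice_IC _ hp) le_rfl)))
  have hsub : univ.pi (fun _ : Unit => Ioi (1 / r)) ⊆ Ici 0 := fun x hx j =>
    hp.trans (le_of_lt (hx j trivial))
  calc _ = ∫⁻ _ in univ.pi (fun _ : Unit => Ioi (1 / r)), ENNReal.ofReal (1 / r)
          ∂Measure.pi fun _ : Unit => expMeasure r := by
        rw [setLIntegral_const, Measure.pi_pi]
        simp only [Finset.univ_unique, Finset.prod_singleton]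
        rw [expMeasure_Ioi hr hp, mul_one_div_cancel hr.ne']
    _ ≤ ∫⁻ x in univ.pi (fun _ : Unit => Ioi (1 / r)),
          ENNReal.ofReal ((postedPrice (1 / r) hp).payment x)
          ∂Measure.pi fun _ : Unit => expMeasure r := by
        refine setLIntegral_mono' (MeasurableSet.univ_pi fun _ => measurableSet_Ioi) fun x hx => ?_
        have : 1 / r ≤ x () := le_of_lt (hx () trivial)
        simp only [postedPrice, if_pos this, le_refl]
    _ ≤ _ := lintegral_mono_set hsub

end Monopoly

theorem mainTheorem5 (m : ℕ) (hm : 0 < m) (lam : Fin m → ℝ) (hlam : ∀ j, 0 < lam j) :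
    0 < Monopoly.G m ∧
    0 < Monopoly.SRev (fun j => expMeasure (lam j)) ∧
    Monopoly.SRev (fun j => expMeasure (lam j)) < ⊤ ∧
    Monopoly.Rev (Measure.pi fun j => expMeasure (lam j)) /
        Monopoly.SRev (fun j => expMeasure (lam j)) ≤
      ENNReal.ofReal (Monopoly.G m / (m ! : ℝ) * Real.exp 1) ∧
    ENNReal.ofReal (1 / (Real.exp 1 * (Monopoly.G m / (m ! : ℝ)))) *
        Monopoly.Rev (Measure.pi fun j => expMeasure (lam j)) ≤
      Monopoly.SRev (fun j => expMeasure (lam j)) ∧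
    Monopoly.G m / (m ! : ℝ) < 1 ∧
    Monopoly.G m / (m ! : ℝ) * Real.exp 1 < Real.exp 1 := by
  have hG := Monopoly.G_pos hm
  have hK : 0 < Monopoly.G m / (m ! : ℝ) := by positivity
  have hK1 : Monopoly.G m / (m ! : ℝ) < 1 :=
    (div_lt_one (by positivity)).2 (Monopoly.G_lt_factorial hm)
  have hlow : (∑ j, ENNReal.ofReal (1 / lam j)) * ENNReal.ofReal (Real.exp (-1)) ≤
      Monopoly.SRev (fun j => expMeasure (lam j)) := by
    rw [Finset.sum_mul]
    exact Finset.sum_le_sum fun j _ => Monopoly.le_Rev_expMeasure (hlam j)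
  have hpos : 0 < Monopoly.SRev (fun j => expMeasure (lam j)) := by
    refine lt_of_lt_of_le (ENNReal.mul_pos ?_ (by simp [Real.exp_pos])) hlow
    have hj : 0 < ENNReal.ofReal (1 / lam ⟨0, hm⟩) :=
      ENNReal.ofReal_pos.2 (one_div_pos.2 (hlam _))
    exact (hj.trans_le (Finset.single_le_sum (f := fun j => ENNReal.ofReal (1 / lam j))
      (fun _ _ => zero_le) (Finset.mem_univ (⟨0, hm⟩ : Fin m)))).ne'
  have htop : Monopoly.SRev (fun j => expMeasure (lam j)) < ⊤ := by
    refine ENNReal.sum_lt_top.2 fun j _ => (Monopoly.Rev_le_lintegral_sum _).trans_lt ?_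
    rw [Monopoly.lintegral_sum_ofReal_pi_expMeasure fun _ => hlam j]
    exact ENNReal.sum_lt_top.2 fun _ _ => ENNReal.ofReal_lt_top
  have hmain : Monopoly.Rev (Measure.pi fun j => expMeasure (lam j)) ≤
      ENNReal.ofReal (Monopoly.G m / (m ! : ℝ) * Real.exp 1) *
        Monopoly.SRev (fun j => expMeasure (lam j)) := by
    refine (Monopoly.Rev_pi_expMeasure_le hm hlam).trans ?_
    refine le_trans (le_of_eq ?_) (mul_le_mul_right hlow _)
    rw [mul_comm (∑ j, ENNReal.ofReal (1 / lam j)), ← mul_assoc,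
      ← ENNReal.ofReal_mul (by positivity), mul_assoc, ← Real.exp_add]
    simp
  refine ⟨hG, hpos, htop, ?_, ?_, hK1, ?_⟩
  · exact ENNReal.div_le_of_le_mul hmain
  · refine (mul_le_mul_right hmain _).trans (le_of_eq ?_)
    rw [← mul_assoc, ← ENNReal.ofReal_mul (by positivity), mul_comm (Real.exp 1),
      one_div_mul_cancel (by positivity), ENNReal.ofReal_one, one_mul]
  · exact mul_lt_of_lt_one_left (Real.exp_pos 1) hK1
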